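/- Ordered abelian groups are totally ordered. For ordered abelian groups $\Gamma_1,\Gamma_2$ let $\Gamma_1\oplus\Gamma_2$ denote the inverse lexicographic product: $(a_1,a_2)<(b_1,b_2)$ if $a_2<b_2$, or $a_2=b_2$ and $a_1<b_1$; in $\mathbb{Z}\oplus\dots\oplus\mathbb{Z}$ two vectors are compared in the last coordinate in which they differ. Write $\equiv$ for elementary equivalence of ordered groups, in the first-order language $\{0,-,+,\le\}$. An ordered abelian group is regular if for every prime number $p$, every quotient by a nontrivial convex subgroup is $p$-divisible. The rank of an ordered abelian group is the number of its proper convex subgroups. (1) If an ordered abelian group $\Gamma$ has a proper convex subgroup $H$ such that the ordered quotient group $\Gamma/H$ is regular, then $\Gamma\equiv\Gamma\oplus\mathbb{Q}$. (2) Every nontrivial ordered abelian group $\Gamma$ of finite rank satisfies $\Gamma\equiv\Gamma\oplus\mathbb{Q}$. (3) In particular, for every $n\ge 1$ the inverse lexicographic sum $\mathbb{Z}^n=\mathbb{Z}\oplus\dots\oplus\mathbb{Z}$ of $n$ copies of $\mathbb{Z}$ has finite rank and satisfies $\mathbb{Z}^n\equiv\mathbb{Z}^n\oplus\mathbb{Q}$.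 -/

import Mathlib

open FirstOrder

universe u

namespace OAG

/-! ### The first-order language of ordered abelian groups -/

/-- The function symbols of the language of ordered abelian groups: `0`, `-` (unary), `+`. -/
inductive Func : ℕ → Type
  | zero : Func 0
  | neg : Func 1
  | add : Func 2

/-- The relation symbol of the language of ordered abelian groups: `≤`. -/
inductive Rel : ℕ → Type
  | le : Rel 2

/-- The language `{0, -, +, ≤}` of ordered abelian groups. -/
def lang : Language where
  Functions := Func
  Relations := Rel

instance instStructure (M : Type*) [Zero M] [Neg M] [Add M] [LE M] : lang.Structure M where
  funMap := fun f => match f with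
    | Func.zero => fun _ => 0
    | Func.neg => fun x => -(x 0)
    | Func.add => fun x => x 0 + x 1
  RelMap := fun r => match r with
    | Rel.le => fun x => x 0 ≤ x 1

/-- `Γ ≡ Δ`: elementary equivalence as ordered groups. -/
abbrev ElemEquiv (Γ Δ : Type*) [AddCommGroup Γ] [LinearOrder Γ] [AddCommGroup Δ] [LinearOrder Δ] :
    Prop :=
  lang.ElementarilyEquivalent Γ Δ

/-! ### Inverse lexicographic sums -/

/-- The inverse lexicographic product `Γ ⊕ Δ`: pairs are compared in the component in `Δ` first,
and in the component in `Γ` only if these agree, so that `Γ` is a convex subgroup of `Γ ⊕ Δ`.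
In Mathlib's lexicographic product `Δ ×ₗ Γ` the left factor is the dominant one. -/
abbrev InvLex (Γ Δ : Type*) : Type _ := Δ ×ₗ Γ

/-- The inverse lexicographic sum `ℤ ⊕ ⋯ ⊕ ℤ` of `n` copies of `ℤ`: vectors are compared at the
largest index at which they differ. -/
abbrev ZPow (n : ℕ) : Type := Colex (Fin n → ℤ)

instance instZPow (n : ℕ) : IsOrderedAddMonoid (ZPow n) where
  add_le_add_left a b hab c := by
    rcases hab.eq_or_lt with h | h
    · rw [h]
    · obtain ⟨i, hi, hlt⟩ := h
      refine le_of_lt ⟨i, fun j hj => ?_, ?_⟩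
      · exact congrArg (· + c j) (hi j hj)
      · exact add_lt_add_left hlt (c i)

/-! ### Convex subgroups and the ordered quotient -/

section Quotient

variable {Γ : Type*} [AddCommGroup Γ] [LinearOrder Γ]

/-- A subgroup is convex if it contains all elements between any two of its elements. -/
abbrev IsConvex (H : AddSubgroup Γ) : Prop := (H : Set Γ).OrdConnected

/-- The order on a quotient: `a ≤ b` if there are representatives `x` of `a` and `y` of `b` with
`x ≤ y`. -/
instance instLEQuotient (H : AddSubgroup Γ) : LE (Γ ⧸ H) where
  le a b := ∃ x y : Γ, (x : Γ ⧸ H) = a ∧ (y : Γ ⧸ H) = b ∧ x ≤ y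

theorem mk_le_mk [IsOrderedAddMonoid Γ] {H : AddSubgroup Γ} {x y : Γ} :
    (x : Γ ⧸ H) ≤ (y : Γ ⧸ H) ↔ ∃ h ∈ H, x ≤ y + h := by
  constructor
  · rintro ⟨x', y', hx, hy, hle⟩
    rw [QuotientAddGroup.eq] at hx hy
    refine ⟨(-x' + x) - (-y' + y), H.sub_mem hx hy, ?_⟩
    have : y + ((-x' + x) - (-y' + y)) = x + (y' - x') := by abel
    rw [this]
    exact le_add_of_nonneg_right (sub_nonneg.2 hle)
  · rintro ⟨h, hh, hle⟩
    exact ⟨x, y + h, rfl, by rw [QuotientAddGroup.eq]; simpa using hh, hle⟩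

/-- The linear order on the quotient by a convex subgroup. -/
noncomputable instance instLinearOrderQuotient [IsOrderedAddMonoid Γ] (H : AddSubgroup Γ)
    [hH : (H : Set Γ).OrdConnected] : LinearOrder (Γ ⧸ H) where
  toLE := instLEQuotient H
  le_refl a := by
    induction a using QuotientAddGroup.induction_on with | H x
    exact ⟨x, x, rfl, rfl, le_rfl⟩
  le_trans a b c := by
    induction a using QuotientAddGroup.induction_on with | H x
    induction b using QuotientAddGroup.induction_on with | H y
    induction c using QuotientAddGroup.induction_on with | H z
    rw [mk_le_mk, mk_le_mk, mk_le_mk]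
    rintro ⟨h, hh, h1⟩ ⟨k, hk, h2⟩
    refine ⟨k + h, H.add_mem hk hh, h1.trans ?_⟩
    rw [← add_assoc]
    gcongr
  le_antisymm a b := by
    induction a using QuotientAddGroup.induction_on with | H x
    induction b using QuotientAddGroup.induction_on with | H y
    rw [mk_le_mk, mk_le_mk]
    rintro ⟨h, hh, h1⟩ ⟨k, hk, h2⟩
    rw [QuotientAddGroup.eq]
    refine hH.out (H.neg_mem hh) hk ⟨?_, ?_⟩
    · have := sub_nonneg.2 h1
      rw [← sub_nonneg]
      convert this using 1
      abel
    · have := sub_nonneg.2 h2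
      rw [← sub_nonneg]
      convert this using 1
      abel
  le_total a b := by
    induction a using QuotientAddGroup.induction_on with | H x
    induction b using QuotientAddGroup.induction_on with | H y
    exact (le_total x y).imp (fun h => ⟨x, y, rfl, rfl, h⟩) (fun h => ⟨y, x, rfl, rfl, h⟩)
  toDecidableLE := Classical.decRel _

instance instIsOrderedAddMonoidQuotient [IsOrderedAddMonoid Γ] (H : AddSubgroup Γ)
    [hH : (H : Set Γ).OrdConnected] : IsOrderedAddMonoid (Γ ⧸ H) where
  add_le_add_left a b hab c := by
    obtain ⟨x, y, rfl, rfl, hle⟩ := hab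
    induction c using QuotientAddGroup.induction_on with | H z
    exact ⟨x + z, y + z, rfl, rfl, by gcongr⟩

end Quotient

/-! ### Regularity and rank -/

/-- `Γ` is `p`-regular if every quotient by a nontrivial convex subgroup is `p`-divisible. -/
def IsPRegular (p : ℕ) (Γ : Type*) [AddCommGroup Γ] [LinearOrder Γ] : Prop :=
  ∀ H : AddSubgroup Γ, IsConvex H → H ≠ ⊥ → ∀ a : Γ ⧸ H, ∃ b : Γ ⧸ H, p • b = a

/-- `Γ` is regular if it is `p`-regular for every prime number `p`. -/
def IsRegular (Γ : Type*) [AddCommGroup Γ] [LinearOrder Γ] : Prop :=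
  ∀ p : ℕ, p.Prime → IsPRegular p Γ

/-- `Γ` has finite rank, the rank being the number of its proper convex subgroups.
(Counting also the improper subgroup does not affect finiteness.) -/
def HasFiniteRank (Γ : Type*) [AddCommGroup Γ] [LinearOrder Γ] : Prop :=
  {H : AddSubgroup Γ | IsConvex H ∧ H ≠ ⊤}.Finite

end OAG

namespace OAG

open Filter FirstOrder.Language

/-! After passing to an ultrapower, `Γ` splits as `C ⊕ D` with `D` divisible and nontrivial, and
first-order logic cannot tell `D` from `D ⊕ *ℚ`. Fix `0 < h ∉ H`. Regularity of `Γ/H` lets every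
element be divided by `i!` with remainder between `0` and `i! • h` (`exists_bounded_remainder`). In
the ultrapower `S`, let `C` be the convex hull of the class of `(i! • h)`. Every element of `S` is
then, modulo `C`, divisible by all positive integers, so `S/C` is divisible; `C` is pure because it
is convex. Hence `C` is a direct summand (`exists_retraction`) and `S ≅ C ⊕ S/C` lexicographically.
An Ehrenfeucht–Fraïssé argument gives `C ⊕ D ≡ C ⊕ D'` for nontrivial divisible `D`, `D'`
(`LexDecomp.elemEquiv`), so `Γ ≡ S ≡ S ⊕ *ℚ ≡ Γ ⊕ ℚ`, the outer steps being Łoś's theorem. In finite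
rank, a maximal proper convex subgroup serves as `H`. -/

/-! ### Łoś's theorem for presentations of ultrapowers -/

/-- A quotient of `ℕ → M` by eventual equality along an ultrafilter, with the operations and the
order defined pointwise, is elementarily equivalent to `M`. -/
theorem elemEquiv_of_ultrapower (U : Ultrafilter ℕ) {M N : Type*}
    [AddCommGroup M] [LinearOrder M] [AddCommGroup N] [LinearOrder N] (π : (ℕ → M) → N)
    (hsurj : Function.Surjective π) (heq : ∀ x y, π x = π y ↔ ∀ᶠ i in U, x i = y i)
    (hzero : π (fun _ => 0) = 0) (hneg : ∀ x, π (fun i => -x i) = -π x)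
    (hadd : ∀ x y, π (fun i => x i + y i) = π x + π y)
    (hle : ∀ x y, π x ≤ π y ↔ ∀ᶠ i in U, x i ≤ y i) : ElemEquiv M N := by
  let f : (U : Filter ℕ).Product (fun _ => M) → N := Quotient.lift π fun x y h => (heq x y).2 h
  have hf : Function.Bijective f := by
    constructor
    · intro a b
      induction a using Quotient.inductionOn with | h x
      induction b using Quotient.inductionOn with | h y
      exact fun h => Quotient.sound ((heq x y).1 h)
    · intro b
      obtain ⟨x, rfl⟩ := hsurj b
      exact ⟨Quotient.mk _ x, rfl⟩
  have rep : ∀ {n : ℕ} (a : Fin n → (U : Filter ℕ).Product (fun _ => M)),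
      ∃ x : Fin n → ℕ → M, a = fun i => (Quotient.mk _ (x i)) := fun a => by
    choose x hx using fun i => Quotient.exists_rep (a i)
    exact ⟨x, funext fun i => (hx i).symm⟩
  let e : (U : Filter ℕ).Product (fun _ => M) ≃[lang] N :=
    { Equiv.ofBijective f hf with
      map_fun' := by
        intro n F a
        obtain ⟨x, rfl⟩ := rep a
        refine (congrArg f (Ultraproduct.funMap_cast (u := U) F x)).trans ?_
        match n, F with
        | _, Func.zero => exact hzero
        | _, Func.neg => exact hneg _
        | _, Func.add => exact hadd _ _
      map_rel' := by
        intro n R a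
        obtain ⟨x, rfl⟩ := rep a
        match n, R with
        | _, Rel.le =>
          refine (hle (x 0) (x 1)).trans ?_
          exact (relMap_quotient_mk' (s := (U : Filter ℕ).productSetoid fun _ => M)
            (L := lang) (Rel.le : lang.Relations 2) x).symm }
  have h1 := StrongHomClass.elementarilyEquivalent e
  refine Eq.trans ?_ h1
  refine elementarilyEquivalent_iff.2 fun φ => ?_
  rw [Ultraproduct.sentence_realize, eventually_const]

/-! ### Ehrenfeucht–Fraïssé comparison over divisible groups -/

/-- Integer forms with coefficients bounded by `N` have the same sign at both tuples. -/
def SameSign {D D' : Type*} [AddCommGroup D] [LinearOrder D] [AddCommGroup D'] [LinearOrder D']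
    {n : ℕ} (N : ℤ) (d : Fin n → D) (d' : Fin n → D') : Prop :=
  ∀ k : Fin n → ℤ, (∀ i, |k i| ≤ N) → (0 ≤ ∑ i, k i • d i ↔ 0 ≤ ∑ i, k i • d' i)

section SameSign

variable {D D' : Type*} [AddCommGroup D] [LinearOrder D] [AddCommGroup D'] [LinearOrder D']

theorem SameSign.symm {n : ℕ} {N : ℤ} {d : Fin n → D} {d' : Fin n → D'} (h : SameSign N d d') :
    SameSign N d' d := fun k hk => (h k hk).symm

theorem SameSign.mono {n : ℕ} {N N' : ℤ} (hN : N ≤ N') {d : Fin n → D} {d' : Fin n → D'}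
    (h : SameSign N' d d') : SameSign N d d' := fun k hk => h k fun i => (hk i).trans hN

variable [IsOrderedAddMonoid D] [IsOrderedAddMonoid D']

theorem SameSign.pos_iff {n : ℕ} {N : ℤ} {d : Fin n → D} {d' : Fin n → D'} (h : SameSign N d d')
    {k : Fin n → ℤ} (hk : ∀ i, |k i| ≤ N) : 0 < ∑ i, k i • d i ↔ 0 < ∑ i, k i • d' i := by
  have := h (-k) (by simpa using hk)
  simp only [Pi.neg_apply, neg_smul, Finset.sum_neg_distrib, Left.nonneg_neg_iff] at this
  rw [← not_le, ← not_le, this]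

theorem SameSign.eq_zero_iff {n : ℕ} {N : ℤ} {d : Fin n → D} {d' : Fin n → D'}
    (h : SameSign N d d') {k : Fin n → ℤ} (hk : ∀ i, |k i| ≤ N) :
    ∑ i, k i • d i = 0 ↔ ∑ i, k i • d' i = 0 := by
  have h1 := h k hk
  have h2 := h.pos_iff hk
  constructor <;> intro h3
  · exact le_antisymm (not_lt.1 fun h4 => by simp [h3] at h2; exact absurd h4 (not_lt.2 h2))
      (h1.1 h3.ge)
  · exact le_antisymm (not_lt.1 fun h4 => by simp [h3] at h2; exact absurd h4 (not_lt.2 h2))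
      (h1.2 h3.ge)

/-- A group is divisible. -/
def IsDivisible (D : Type*) [AddCommGroup D] : Prop := ∀ n : ℕ, n ≠ 0 → ∀ a : D, ∃ b : D, n • b = a

theorem IsDivisible.densely (hD : IsDivisible D) : DenselyOrdered D where
  dense a b hab := by
    obtain ⟨c, hc⟩ := hD 2 two_ne_zero (a + b)
    rw [two_nsmul] at hc
    refine ⟨c, lt_of_not_ge fun h => ?_, lt_of_not_ge fun h => ?_⟩
    · have := add_lt_add_of_le_of_lt h (h.trans_lt hab)
      exact this.ne hc
    · have := add_lt_add_of_lt_of_le (hab.trans_le h) h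
      exact this.ne' hc

/-- The sign of `k·d + l e` with `l ≠ 0` is the position of `e` relative to a cut point `-(k·d)/l`.
Comparing two cut points involves coefficients `l' k - l k'`, bounded by `2N²`; the extra `N` covers
forms with `l = 0`. Density without endpoints then supplies `e'` in the corresponding cut. -/
theorem SameSign.extend [Nontrivial D'] (hD : IsDivisible D) (hD' : IsDivisible D') {n : ℕ}
    (N : ℤ) (hN : 0 ≤ N) {d : Fin n → D} {d' : Fin n → D'} (h : SameSign (2 * N * N + N) d d')
    (e : D) : ∃ e' : D', SameSign N (Fin.snoc d e : Fin (n + 1) → D)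
      (Fin.snoc d' e' : Fin (n + 1) → D') := by
  have := hD'.densely
  have : NoMinOrder D' := inferInstance
  have : NoMaxOrder D' := inferInstance
  -- Corresponding cut points in `D` and `D'`; the value for `l ≤ 0` is junk.
  have key : ∀ p : (Fin n → ℤ) × ℤ, ∃ q : D × D', 0 < p.2 →
      p.2 • q.1 = -∑ i, p.1 i • d i ∧ p.2 • q.2 = -∑ i, p.1 i • d' i := by
    rintro ⟨k, l⟩
    by_cases hl : 0 < l
    · lift l to ℕ using hl.le
      obtain ⟨a, ha⟩ := hD l (by lia) (-∑ i, k i • d i)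
      obtain ⟨b, hb⟩ := hD' l (by lia) (-∑ i, k i • d' i)
      exact ⟨(a, b), fun _ => by simpa using ⟨ha, hb⟩⟩
    · exact ⟨0, fun h => absurd h hl⟩
  choose q hq using key
  let S : Finset ((Fin n → ℤ) × ℤ) :=
    (Fintype.piFinset fun _ => Finset.Icc (-N) N) ×ˢ Finset.Icc 1 N
  have memS : ∀ {k l}, (k, l) ∈ S ↔ (∀ i, |k i| ≤ N) ∧ 1 ≤ l ∧ l ≤ N := by
    intro k l
    simp [S, Fintype.mem_piFinset, abs_le]
  classical
  have le_iff : ∀ p ∈ S, ∀ p' ∈ S, ((q p).1 ≤ (q p').1 ↔ (q p).2 ≤ (q p').2) := by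
    rintro ⟨k, l⟩ hp ⟨k', l'⟩ hp'
    rw [memS] at hp hp'
    have hl : 0 < l := by lia
    have hl' : 0 < l' := by lia
    obtain ⟨h1, h2⟩ := hq (k, l) hl
    obtain ⟨h3, h4⟩ := hq (k', l') hl'
    simp only at h1 h2 h3 h4
    rw [← zsmul_le_zsmul_iff_right (mul_pos hl hl'), ← sub_nonneg,
      ← zsmul_le_zsmul_iff_right (mul_pos hl hl') (a := (q (k, l)).2), ← sub_nonneg (b := _ • (q (k, l)).2)]
    have := h (fun i => l' * k i - l * k' i) (fun i => by
      have e1 : |l' * k i| ≤ N * N := by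
        rw [abs_mul, abs_of_pos hl']
        exact mul_le_mul hp'.2.2 (hp.1 i) (abs_nonneg _) hN
      have e2 : |l * k' i| ≤ N * N := by
        rw [abs_mul, abs_of_pos hl]
        exact mul_le_mul hp.2.2 (hp'.1 i) (abs_nonneg _) hN
      have := abs_sub (l' * k i) (l * k' i)
      linarith)
    have a1 : (l * l') • (q (k', l')).1 - (l * l') • (q (k, l)).1
        = ∑ i, (l' * k i - l * k' i) • d i := by
      rw [mul_smul, h3, mul_comm l l', mul_smul, h1]
      simp only [sub_smul, mul_smul, Finset.sum_sub_distrib, ← Finset.smul_sum, smul_neg]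
      abel
    have a2 : (l * l') • (q (k', l')).2 - (l * l') • (q (k, l)).2
        = ∑ i, (l' * k i - l * k' i) • d' i := by
      rw [mul_smul, h4, mul_comm l l', mul_smul, h2]
      simp only [sub_smul, mul_smul, Finset.sum_sub_distrib, ← Finset.smul_sum, smul_neg]
      abel
    rw [a1, a2]
    exact this
  -- The finitely many cut points form a partial isomorphism, extended to `e` as in Cantor's
  -- back-and-forth.
  let f : Order.PartialIso D D' := ⟨S.image q, by
    intro a ha b hb
    obtain ⟨p, hp, rfl⟩ := Finset.mem_image.1 ha
    obtain ⟨p', hp', rfl⟩ := Finset.mem_image.1 hb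
    simp only [cmp, cmpUsing, ← not_le, le_iff p hp p' hp', le_iff p' hp' p hp]⟩
  obtain ⟨e', he'⟩ := f.exists_across e
  have cut : ∀ p ∈ S, ((q p).1 ≤ e ↔ (q p).2 ≤ e') ∧ (e ≤ (q p).1 ↔ e' ≤ (q p).2) := by
    intro p hp
    have := he' (q p) (Finset.mem_image_of_mem q hp)
    exact ⟨le_iff_le_of_cmp_eq_cmp this, le_iff_le_of_cmp_eq_cmp (cmp_eq_cmp_symm.1 this)⟩
  refine ⟨e', fun k hk => ?_⟩
  simp only [Fin.sum_univ_castSucc, Fin.snoc_castSucc, Fin.snoc_last]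
  set l := k (Fin.last n) with hl
  have hlN := abs_le.1 (hk (Fin.last n))
  rcases lt_trichotomy l 0 with h0 | h0 | h0
  · have hp : ((fun i => -k (Fin.castSucc i)), -l) ∈ S :=
      memS.2 ⟨fun i => by rw [abs_neg]; exact hk _, by lia, by lia⟩
    obtain ⟨h1, h2⟩ := hq ((fun i => -k (Fin.castSucc i)), -l) (by simpa using h0)
    have h3 := (cut _ hp).2
    rw [← zsmul_le_zsmul_iff_right (neg_pos.2 h0), ← zsmul_le_zsmul_iff_right (neg_pos.2 h0) (a := e'),
      h1, h2] at h3
    simpa [← sub_nonneg] using h3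
  · have := h (fun i => k (Fin.castSucc i)) (fun i => (hk _).trans (by nlinarith))
    simpa [h0] using this
  · have hp : ((fun i => k (Fin.castSucc i)), l) ∈ S :=
      memS.2 ⟨fun i => hk _, by lia, by lia⟩
    obtain ⟨h1, h2⟩ := hq ((fun i => k (Fin.castSucc i)), l) h0
    have h3 := (cut _ hp).1
    rw [← zsmul_le_zsmul_iff_right h0, ← zsmul_le_zsmul_iff_right h0 (b := e'), h1, h2] at h3
    simpa [← sub_nonneg, add_comm] using h3

end SameSign

/-- A presentation of the ordered group `G` as the inverse lexicographic product `C ⊕ D`. -/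
structure LexDecomp (C D G : Type*) [AddCommGroup C] [LinearOrder C] [AddCommGroup D]
    [LinearOrder D] [AddCommGroup G] [LinearOrder G] where
  /-- The projection to the convex part. -/
  low : G →+ C
  /-- The projection to the dominant part. -/
  high : G →+ D
  nonneg_iff : ∀ x, 0 ≤ x ↔ 0 < high x ∨ high x = 0 ∧ 0 ≤ low x
  surj : ∀ c d, ∃ x, low x = c ∧ high x = d

/-- The coefficients do not depend on the group, so one bound serves both sides of a comparison. -/
theorem exists_coeff {n : ℕ} (t : lang.Term (Empty ⊕ Fin n)) :
    ∃ k : Fin n → ℤ, ∀ (G : Type u) [AddCommGroup G] [LinearOrder G] (a : Empty → G)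
      (v : Fin n → G), t.realize (Sum.elim a v) = ∑ i, k i • v i := by
  induction t with
  | var x =>
    rcases x with x | j
    · exact x.elim
    · exact ⟨Pi.single j 1, fun G _ _ a v => by
        simp [Pi.single_apply, ite_smul]⟩
  | @func l f ts ih =>
    choose k hk using ih
    match l, f with
    | _, Func.zero => exact ⟨0, fun G _ _ a v => by simp; rfl⟩
    | _, Func.neg =>
      refine ⟨-k 0, fun G _ _ a v => ?_⟩
      have : -((ts 0).realize (Sum.elim a v)) = ∑ i, (-k 0) i • v i := by
        rw [hk]; simp
      exact this
    | _, Func.add =>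
      refine ⟨k 0 + k 1, fun G _ _ a v => ?_⟩
      have : (ts 0).realize (Sum.elim a v) + (ts 1).realize (Sum.elim a v)
          = ∑ i, (k 0 + k 1) i • v i := by
        rw [hk, hk]; simp [add_smul, Finset.sum_add_distrib]
      exact this

/-! ### Transfer of formulas between lexicographic sums with the same convex part -/

section Comparison

variable {C D D' : Type*} {G G' : Type u} [AddCommGroup C] [LinearOrder C]
  [AddCommGroup D] [LinearOrder D] [IsOrderedAddMonoid D]
  [AddCommGroup D'] [LinearOrder D'] [IsOrderedAddMonoid D']
  [AddCommGroup G] [LinearOrder G] [IsOrderedAddMonoid G]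
  [AddCommGroup G'] [LinearOrder G'] [IsOrderedAddMonoid G']

theorem realize_le_iff_of_sameSign (p : LexDecomp C D G) (p' : LexDecomp C D' G') {n : ℕ}
    (s t : lang.Term (Empty ⊕ Fin n)) : ∃ N : ℤ, 0 ≤ N ∧ ∀ (v : Fin n → G) (v' : Fin n → G'),
      p.low ∘ v = p'.low ∘ v' → SameSign N (p.high ∘ v) (p'.high ∘ v') →
      ∀ (a : Empty → G) (a' : Empty → G'),
        (s.realize (Sum.elim a v) ≤ t.realize (Sum.elim a v) ↔
          s.realize (Sum.elim a' v') ≤ t.realize (Sum.elim a' v')) := by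
  obtain ⟨k, hk⟩ := exists_coeff.{u} s
  obtain ⟨l, hl⟩ := exists_coeff.{u} t
  refine ⟨∑ i, |l i - k i|, Finset.sum_nonneg fun i _ => abs_nonneg _, fun v v' h h' a a' => ?_⟩
  have hb : ∀ i, |(fun i => l i - k i) i| ≤ ∑ i, |l i - k i| := fun i =>
    Finset.single_le_sum (f := fun i => |l i - k i|) (fun i _ => abs_nonneg _) (Finset.mem_univ i)
  rw [hk, hl, hk, hl, ← sub_nonneg, ← sub_nonneg (a := ∑ i, l i • v' i),
    ← Finset.sum_sub_distrib, ← Finset.sum_sub_distrib]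
  simp only [← sub_smul]
  rw [p.nonneg_iff, p'.nonneg_iff]
  have hlow : ∀ i, p.low (v i) = p'.low (v' i) := fun i => congrFun h i
  have h1 := h'.pos_iff hb
  have h2 := h'.eq_zero_iff hb
  simp only [Function.comp_apply] at h1 h2
  simp only [map_sum, map_zsmul, hlow, h1, h2]

/-- Each quantifier raises the bound from `N` to `2N² + N`. A new element is answered by one with
the same component in `C` and a dominant component from `SameSign.extend`. -/
theorem realize_iff_of_sameSign [Nontrivial D] [Nontrivial D'] (hD : IsDivisible D)
    (hD' : IsDivisible D') (p : LexDecomp C D G) (p' : LexDecomp C D' G') {n : ℕ}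
    (φ : lang.BoundedFormula Empty n) : ∃ N : ℤ, 0 ≤ N ∧ ∀ (v : Fin n → G) (v' : Fin n → G'),
      p.low ∘ v = p'.low ∘ v' → SameSign N (p.high ∘ v) (p'.high ∘ v') →
      ∀ (a : Empty → G) (a' : Empty → G'), (φ.Realize a v ↔ φ.Realize a' v') := by
  induction φ with
  | falsum => exact ⟨0, le_rfl, fun _ _ _ _ _ _ => Iff.rfl⟩
  | equal s t =>
    obtain ⟨N, hN, h⟩ := realize_le_iff_of_sameSign p p' s t
    obtain ⟨N', hN', h'⟩ := realize_le_iff_of_sameSign p p' t s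
    refine ⟨N + N', by lia, fun v v' hv hs a a' => ?_⟩
    have h1 := h v v' hv (hs.mono (by lia)) a a'
    have h2 := h' v v' hv (hs.mono (by lia)) a a'
    simp only [BoundedFormula.Realize]
    rw [le_antisymm_iff, le_antisymm_iff, h1, h2]
  | @rel n l R ts =>
    match l, R with
    | _, Rel.le =>
      obtain ⟨N, hN, h⟩ := realize_le_iff_of_sameSign p p' (ts 0) (ts 1)
      exact ⟨N, hN, h⟩
  | imp φ ψ ih₁ ih₂ =>
    obtain ⟨N, hN, h⟩ := ih₁
    obtain ⟨N', hN', h'⟩ := ih₂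
    refine ⟨N + N', by lia, fun v v' hv hs a a' => ?_⟩
    have h1 := h v v' hv (hs.mono (by lia)) a a'
    have h2 := h' v v' hv (hs.mono (by lia)) a a'
    simp only [BoundedFormula.Realize, h1, h2]
  | all φ ih =>
    obtain ⟨N, hN, h⟩ := ih
    refine ⟨2 * N * N + N, by positivity, fun v v' hv hs a a' => ?_⟩
    simp only [BoundedFormula.Realize]
    constructor
    · intro H x'
      obtain ⟨e, he⟩ := hs.symm.extend hD' hD N hN (p'.high x')
      obtain ⟨x, hx1, hx2⟩ := p.surj (p'.low x') e
      refine (h (Fin.snoc v x) (Fin.snoc v' x') ?_ ?_ a a').1 (H x)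
      · rw [Fin.comp_snoc, Fin.comp_snoc, hv, hx1]
      · rw [Fin.comp_snoc, Fin.comp_snoc, hx2]
        exact he.symm
    · intro H x
      obtain ⟨e, he⟩ := hs.extend hD hD' N hN (p.high x)
      obtain ⟨x', hx1, hx2⟩ := p'.surj (p.low x) e
      refine (h (Fin.snoc v x) (Fin.snoc v' x') ?_ ?_ a a').2 (H x')
      · rw [Fin.comp_snoc, Fin.comp_snoc, hv, hx1]
      · rw [Fin.comp_snoc, Fin.comp_snoc, hx2]
        exact he

/-- `C ⊕ D ≡ C ⊕ D'` for all nontrivial divisible ordered abelian groups `D` and `D'`. -/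
theorem LexDecomp.elemEquiv [Nontrivial D] [Nontrivial D'] (hD : IsDivisible D)
    (hD' : IsDivisible D') (p : LexDecomp C D G) (p' : LexDecomp C D' G') : ElemEquiv G G' := by
  refine elementarilyEquivalent_iff.2 fun φ => ?_
  obtain ⟨N, -, h⟩ := realize_iff_of_sameSign hD hD' p p' φ
  exact h _ _ (Subsingleton.elim _ _) (fun k _ => by simp) _ _

end Comparison

/-! ### Convex hulls and regular groups -/

section Hull

variable {G : Type*} [AddCommGroup G] [LinearOrder G]

theorem mk_nonneg (H : AddSubgroup G) {x : G} (hx : 0 ≤ x) :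
    0 ≤ (x : G ⧸ H) :=
  ⟨0, x, rfl, rfl, hx⟩

theorem IsRegular.isDivisible_quotient (hG : IsRegular G) (K : AddSubgroup G) (hK : IsConvex K)
    (hK' : K ≠ ⊥) : IsDivisible (G ⧸ K) := by
  intro n
  induction n using induction_on_primes with
  | zero => exact fun h => absurd rfl h
  | one => exact fun _ a => ⟨a, one_smul _ a⟩
  | prime_mul p n hp ih =>
    intro hn a
    obtain ⟨b, rfl⟩ := hG p hp K hK hK' a
    obtain ⟨c, rfl⟩ := ih (right_ne_zero_of_mul hn) b
    exact ⟨c, mul_smul _ _ _⟩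

variable [IsOrderedAddMonoid G]

/-- The convex subgroup generated by a nonnegative element `w`. -/
def hull (w : G) : AddSubgroup G where
  carrier := {x | ∃ m : ℕ, |x| ≤ m • w}
  zero_mem' := ⟨0, by simp⟩
  add_mem' := by
    rintro a b ⟨m, hm⟩ ⟨k, hk⟩
    exact ⟨m + k, (abs_add_le a b).trans (by rw [add_smul]; exact add_le_add hm hk)⟩
  neg_mem' := by
    rintro a ⟨m, hm⟩
    exact ⟨m, by rwa [abs_neg]⟩

instance instOrdConnectedHull (w : G) : (hull w : Set G).OrdConnected where
  out' := by
    rintro x ⟨m, hm⟩ y ⟨k, hk⟩ z ⟨h1, h2⟩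
    refine ⟨m + k, (abs_le_max_abs_abs h1 h2).trans ?_⟩
    have h3 := abs_nonneg x
    have h4 := abs_nonneg y
    rw [add_smul]
    exact max_le (hm.trans (le_add_of_nonneg_right (h4.trans hk)))
      (hk.trans (le_add_of_nonneg_left (h3.trans hm)))

theorem mem_of_nsmul_mem (C : AddSubgroup G) [hC : (C : Set G).OrdConnected] {n : ℕ} (hn : n ≠ 0)
    {x : G} (h : n • x ∈ C) : x ∈ C := by
  wlog hx : 0 ≤ x generalizing x
  · rw [← neg_mem_iff]
    exact this (by rw [smul_neg]; exact C.neg_mem h) (neg_nonneg.2 (le_of_not_ge hx))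
  · exact hC.out C.zero_mem h ⟨hx, le_self_nsmul hx hn⟩

/-- Division with remainder without an Archimedean hypothesis: the bound `m • t` replaces it. -/
theorem exists_sub_nsmul_mem_Icc {t : G} (ht : 0 ≤ t) (m : ℕ) :
    ∀ {x : G}, 0 ≤ x → x ≤ m • t → ∃ q : ℕ, 0 ≤ x - q • t ∧ x - q • t ≤ t := by
  induction m with
  | zero => exact fun h0 h1 => ⟨0, by simpa using h0, by simpa using h1.trans (by simpa using ht)⟩
  | succ m ih =>
    intro x h0 h1
    rcases le_total x t with h | h
    · exact ⟨0, by simpa using h0, by simpa using h⟩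
    · obtain ⟨q, hq⟩ := ih (x := x - t) (sub_nonneg.2 h) (by rwa [sub_le_iff_le_add, ← succ_nsmul])
      refine ⟨q + 1, ?_⟩
      rwa [succ_nsmul', ← sub_sub]

/-- Modulo the hull of the image of `h`, which is nontrivial as `h ∉ H`, regularity makes `g`
divisible by `n`. The error is bounded by a multiple of `h` and is reduced by multiples of `n • h`.
-/
theorem exists_bounded_remainder (H : AddSubgroup G) [hH : (H : Set G).OrdConnected]
    (hreg : IsRegular (G ⧸ H)) {h : G} (h0 : 0 ≤ h) (hh : h ∉ H) {n : ℕ} (hn : n ≠ 0) (g : G) :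
    ∃ y c : G, n • y = g - c ∧ 0 ≤ c ∧ c ≤ n • h := by
  have hK : hull (h : G ⧸ H) ≠ ⊥ := by
    intro hbot
    have : (h : G ⧸ H) ∈ hull (h : G ⧸ H) := ⟨1, by rw [one_smul, abs_of_nonneg (mk_nonneg H h0)]⟩
    rw [hbot, AddSubgroup.mem_bot, QuotientAddGroup.eq_zero_iff] at this
    exact hh this
  -- The additional `h` absorbs the element of `H` lost in lifting, since `h` exceeds all of `H`.
  have bound : ∀ {x : G} {m : ℕ}, (x : G ⧸ H) ≤ m • (h : G ⧸ H) → x ≤ (m + 1) • h := by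
    intro x m hx
    obtain ⟨η, hη, hle⟩ := mk_le_mk.1 (show (x : G ⧸ H) ≤ ((m • h : G) : G ⧸ H) from hx)
    refine hle.trans ?_
    rw [succ_nsmul]
    gcongr
    exact le_of_not_ge fun h1 => hh (hH.out H.zero_mem hη ⟨h0, h1⟩)
  obtain ⟨b, hb⟩ := hreg.isDivisible_quotient (hull (h : G ⧸ H)) inferInstance hK n hn
    ((g : G ⧸ H) : (G ⧸ H) ⧸ hull (h : G ⧸ H))
  induction b using QuotientAddGroup.induction_on with | H b
  induction b using QuotientAddGroup.induction_on with | H y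
  obtain ⟨m, hm⟩ := QuotientAddGroup.eq.1 hb
  change |((-(n • y) + g : G) : G ⧸ H)| ≤ _ at hm
  set x := -(n • y) + g with hx
  have h1 : x ≤ (m + 1) • h := bound ((le_abs_self _).trans hm)
  have h2 : -x ≤ (m + 1) • h := bound ((neg_le_abs _).trans hm)
  have ht : h ≤ n • h := le_self_nsmul h0 hn
  have h3 : (m + 1) • h ≤ (m + 1) • (n • h) := nsmul_le_nsmul_right ht _
  -- Shifting by a multiple of `n • h` makes the error nonnegative without changing it modulo `n`.
  obtain ⟨q, hq1, hq2⟩ := exists_sub_nsmul_mem_Icc (t := n • h) (h0.trans ht) ((m + 1) + (m + 1))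
    (x := x + (m + 1) • (n • h)) (by rw [← neg_le_iff_add_nonneg']; exact h2.trans h3)
    (by rw [add_smul (m + 1) (m + 1)]; exact add_le_add (h1.trans h3) le_rfl)
  refine ⟨y - (m + 1) • h + q • h, _, ?_, hq1, hq2⟩
  rw [hx, smul_add, smul_sub, smul_comm n, smul_comm n]
  abel

end Hull

/-! ### Splitting off a convex subgroup -/

/-- A pure subgroup `C` is a retract if every element is congruent modulo `C` to an element
divisible by all positive integers. -/
theorem exists_retraction {A : Type*} [AddCommGroup A] [IsAddTorsionFree A] (C : AddSubgroup A)
    (hC : ∀ (n : ℕ) (x : A), n ≠ 0 → n • x ∈ C → x ∈ C)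
    (h : ∀ g : A, ∃ c ∈ C, ∀ n : ℕ, n ≠ 0 → ∃ y, n • y = g - c) :
    ∃ r : A →+ C, ∀ c : C, r c = c := by
  let E : AddSubgroup A :=
    { carrier := {x | ∀ n : ℕ, n ≠ 0 → ∃ y, n • y = x}
      zero_mem' := fun n _ => ⟨0, smul_zero n⟩
      add_mem' := fun {a b} ha hb n hn => by
        obtain ⟨y, rfl⟩ := ha n hn
        obtain ⟨z, rfl⟩ := hb n hn
        exact ⟨y + z, smul_add _ _ _⟩
      neg_mem' := fun {a} ha n hn => by
        obtain ⟨y, rfl⟩ := ha n hn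
        exact ⟨-y, smul_neg _ _⟩ }
  have hE : ∀ (n : ℕ) (x : A), n ≠ 0 → n • x ∈ E → x ∈ E := by
    intro n x hn hx k hk
    obtain ⟨y, hy⟩ := hx (n * k) (mul_ne_zero hn hk)
    refine ⟨y, nsmul_right_injective hn ?_⟩
    rwa [mul_smul] at hy
  -- `K` is divisible, hence injective, so it has a retraction `r`. The choice of `c a` is unique up
  -- to `K`, and `r` fixes `K`, so `c a + r (a - c a)` does not depend on it and is therefore
  -- additive.
  let K := C ⊓ E
  have hdiv : ∀ {n : ℤ} (x : K), n ≠ 0 → ∃ y : K, n • y = x := by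
    have hnat : ∀ {n : ℕ} (x : K), n ≠ 0 → ∃ y : K, n • y = x := by
      rintro n ⟨x, hxC, hxE⟩ hn
      obtain ⟨y, rfl⟩ := hxE n hn
      exact ⟨⟨y, hC n y hn hxC, hE n y hn hxE⟩, rfl⟩
    intro n x hn
    obtain ⟨y, hy⟩ := hnat x (Int.natAbs_ne_zero.2 hn)
    rcases Int.natAbs_eq n with h | h
    · exact ⟨y, by rw [h, natCast_zsmul, hy]⟩
    · exact ⟨-y, by rw [h, neg_smul, smul_neg, neg_neg, natCast_zsmul, hy]⟩
  let _ : DivisibleBy K ℤ := divisibleByOfSMulRightSurj K ℤ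
    fun {n} hn x => hdiv x hn
  obtain ⟨r, hr⟩ := (Module.Baer.of_divisible K).extension_property_addMonoidHom K.subtype
    K.subtype_injective (AddMonoidHom.id K)
  have hrK : ∀ x (hx : x ∈ K), ((r x : K) : A) = x := fun x hx =>
    congrArg Subtype.val (DFunLike.congr_fun hr ⟨x, hx⟩)
  choose c hcC hcE using h
  have add_spec : ∀ a b : A, c (a + b) + r (a + b - c (a + b)) =
      c a + r (a - c a) + (c b + r (b - c b)) := by
    intro a b
    have hmem : c (a + b) - c a - c b ∈ K := by
      refine ⟨C.sub_mem (C.sub_mem (hcC _) (hcC _)) (hcC _), ?_⟩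
      have := E.sub_mem (E.add_mem (hcE a) (hcE b)) (hcE (a + b))
      change _ ∈ E
      convert this using 1
      abel
    have e := hrK _ hmem
    simp only [map_sub, map_add, AddSubgroup.coe_sub, AddSubgroup.coe_add] at e ⊢
    rw [← sub_eq_zero] at e ⊢
    rw [← neg_eq_zero, ← e]
    abel
  refine ⟨AddMonoidHom.mk' (fun a => ⟨c a + r (a - c a), C.add_mem (hcC a) (r _).2.1⟩)
    fun a b => Subtype.ext (add_spec a b), fun a => Subtype.ext ?_⟩
  have hmem : (a : A) - c a ∈ K := ⟨C.sub_mem a.2 (hcC a), hcE a⟩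
  change c a + ((r (a - c a) : K) : A) = a
  rw [hrK _ hmem]
  abel

/-! ### Lexicographic decompositions from retractions -/

section Decomp

variable {G : Type*} [AddCommGroup G] [LinearOrder G] [IsOrderedAddMonoid G]

/-- The decomposition given by a retraction onto a convex subgroup. -/
noncomputable def LexDecomp.ofRetraction (C : AddSubgroup G) [(C : Set G).OrdConnected]
    (r : G →+ C) (hr : ∀ c : C, r c = c) : LexDecomp C (G ⧸ C) G where
  low := r
  high := QuotientAddGroup.mk' C
  nonneg_iff x := by
    have hz : (x : G ⧸ C) = 0 ↔ x ∈ C := QuotientAddGroup.eq_zero_iff x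
    change 0 ≤ x ↔ 0 < (x : G ⧸ C) ∨ (x : G ⧸ C) = 0 ∧ 0 ≤ r x
    by_cases hx : x ∈ C
    · have h1 := hz.2 hx
      have h2 : r x = ⟨x, hx⟩ := hr ⟨x, hx⟩
      rw [h1, h2]
      simp [← Subtype.coe_le_coe]
    · have h1 := mt hz.1 hx
      simp only [h1, false_and, or_false]
      refine ⟨fun h => lt_of_le_of_ne (mk_nonneg C h) (Ne.symm h1), fun h => ?_⟩
      by_contra h2
      have h3 := mk_nonneg C (neg_nonneg.2 (le_of_not_ge h2))
      rw [QuotientAddGroup.mk_neg, neg_nonneg] at h3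
      exact absurd h (not_lt.2 h3)
  surj c d := by
    induction d using QuotientAddGroup.induction_on with | H g
    refine ⟨g - r g + c, by simp [hr], ?_⟩
    refine QuotientAddGroup.eq.2 ?_
    have : -(g - r g + c) + g = ((r g - c : C) : G) := by
      rw [AddSubgroup.coe_sub]; abel
    rw [this]
    exact Subtype.prop _

/-- Adding a dominant summand. -/
def LexDecomp.prod {C D : Type*} [AddCommGroup C] [LinearOrder C] [AddCommGroup D] [LinearOrder D]
    (p : LexDecomp C D G) (E : Type*) [AddCommGroup E] [LinearOrder E] :
    LexDecomp C (E ×ₗ D) (E ×ₗ G) where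
  low := AddMonoidHom.mk' (fun x => p.low (ofLex x).2) fun a b => map_add p.low _ _
  high := AddMonoidHom.mk' (fun x => toLex ((ofLex x).1, p.high (ofLex x).2)) fun a b =>
    congrArg (fun t => toLex ((ofLex a).1 + (ofLex b).1, t)) (map_add p.high _ _)
  nonneg_iff x := by
    have h := p.nonneg_iff (ofLex x).2
    have h1 : (0 : E ×ₗ G) ≤ x ↔ 0 < (ofLex x).1 ∨ 0 = (ofLex x).1 ∧ 0 ≤ (ofLex x).2 :=
      Prod.Lex.le_iff
    have h2 : (0 : E ×ₗ D) < toLex ((ofLex x).1, p.high (ofLex x).2) ↔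
        0 < (ofLex x).1 ∨ 0 = (ofLex x).1 ∧ 0 < p.high (ofLex x).2 := Prod.Lex.lt_iff
    have h3 : toLex ((ofLex x).1, p.high (ofLex x).2) = (0 : E ×ₗ D) ↔
        (ofLex x).1 = 0 ∧ p.high (ofLex x).2 = 0 := Prod.ext_iff
    change _ ↔ (0 : E ×ₗ D) < toLex ((ofLex x).1, p.high (ofLex x).2) ∨
      toLex ((ofLex x).1, p.high (ofLex x).2) = (0 : E ×ₗ D) ∧ 0 ≤ p.low (ofLex x).2
    rw [h1, h2, h3, h]
    grind
  surj c d := by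
    obtain ⟨x, hx1, hx2⟩ := p.surj c (ofLex d).2
    exact ⟨toLex ((ofLex d).1, x), hx1, congrArg (fun t => toLex ((ofLex d).1, t)) hx2⟩

end Decomp

theorem IsDivisible.lexProd {D E : Type*} [AddCommGroup D] [AddCommGroup E] (hD : IsDivisible D)
    (hE : IsDivisible E) : IsDivisible (E ×ₗ D) := by
  intro n hn a
  obtain ⟨x, hx⟩ := hE n hn (ofLex a).1
  obtain ⟨y, hy⟩ := hD n hn (ofLex a).2
  exact ⟨toLex (x, y), congrArg toLex (Prod.ext hx hy)⟩

/-! ### The theorem on regular quotients -/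

theorem isDivisible_germ_rat (l : Filter ℕ) : IsDivisible (Germ l ℚ) := by
  intro n hn a
  induction a using Germ.inductionOn with | _ x
  refine ⟨((fun i => x i / n : ℕ → ℚ) : Germ l ℚ), ?_⟩
  rw [← Germ.coe_smul]
  refine congrArg _ (funext fun i => ?_)
  have : (n : ℚ) ≠ 0 := by exact_mod_cast hn
  simp [field]

theorem elemEquiv_germ (U : Ultrafilter ℕ) (G : Type*) [AddCommGroup G] [LinearOrder G] :
    ElemEquiv G (Germ (U : Filter ℕ) G) :=
  elemEquiv_of_ultrapower U (fun x => (x : Germ (U : Filter ℕ) G)) Quotient.mk_surjective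
    (fun _ _ => Germ.coe_eq) rfl (fun _ => rfl) (fun _ _ => rfl) (fun _ _ => Germ.coe_le)

theorem elemEquiv_lex_germ (U : Ultrafilter ℕ) (E G : Type*) [AddCommGroup E] [LinearOrder E]
    [AddCommGroup G] [LinearOrder G] :
    ElemEquiv (E ×ₗ G) (Germ (U : Filter ℕ) E ×ₗ Germ (U : Filter ℕ) G) := by
  refine elemEquiv_of_ultrapower U (fun x => toLex
    (((fun i => (ofLex (x i)).1 : ℕ → E) : Germ (U : Filter ℕ) E),
      ((fun i => (ofLex (x i)).2 : ℕ → G) : Germ (U : Filter ℕ) G))) ?_ ?_ rfl (fun _ => rfl)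
    (fun _ _ => rfl) ?_
  · intro b
    obtain ⟨x, hx⟩ := Quotient.mk_surjective (ofLex b).1
    obtain ⟨y, hy⟩ := Quotient.mk_surjective (ofLex b).2
    exact ⟨fun i => toLex (x i, y i), congrArg toLex (Prod.ext hx hy)⟩
  · intro x y
    rw [toLex_inj, Prod.ext_iff, Germ.coe_eq, Germ.coe_eq]
    simp only [EventuallyEq, ← eventually_and, ← Prod.ext_iff]
    rfl
  · intro x y
    rw [Prod.Lex.le_iff]
    simp only [ofLex_toLex, Prod.Lex.le_iff, Ultrafilter.eventually_or, eventually_and]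
    rw [Germ.coe_lt, Germ.coe_eq, Germ.coe_le]
    rfl

theorem elemEquiv_of_regular_quotient (Γ : Type u) [AddCommGroup Γ] [LinearOrder Γ]
    [IsOrderedAddMonoid Γ] (H : AddSubgroup Γ) [(H : Set Γ).OrdConnected] (hH : H ≠ ⊤)
    (hreg : IsRegular (Γ ⧸ H)) : ElemEquiv Γ (InvLex Γ ℚ) := by
  obtain ⟨h, h0, hh⟩ : ∃ h : Γ, 0 ≤ h ∧ h ∉ H := by
    obtain ⟨h, hh⟩ := not_forall.1 (mt (AddSubgroup.eq_top_iff' H).2 hH)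
    rcases le_total 0 h with h0 | h0
    · exact ⟨h, h0, hh⟩
    · exact ⟨-h, neg_nonneg.2 h0, by rwa [neg_mem_iff]⟩
  have hpos : 0 < h := h0.lt_of_ne (by rintro rfl; exact hh H.zero_mem)
  let U : Ultrafilter ℕ := hyperfilter ℕ
  have hU : ∀ m : ℕ, ∀ᶠ i in (U : Filter ℕ), m ≤ i := fun m =>
    Nat.hyperfilter_le_atTop (eventually_ge_atTop m)
  let S := Germ (U : Filter ℕ) Γ
  -- Factorials handle all `n` at once: `n ∣ i!` as soon as `i ≥ n ≥ 1`.
  let w : S := ((fun i => i.factorial • h : ℕ → Γ) : S)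
  let C : AddSubgroup S := hull w
  have split : ∀ g : S, ∃ c ∈ C, ∀ n : ℕ, n ≠ 0 → ∃ y, n • y = g - c := by
    intro g
    induction g using Germ.inductionOn with | _ x
    choose y c hyc hc0 hch using fun i =>
      exists_bounded_remainder H hreg h0 hh (Nat.factorial_ne_zero i) (x i)
    refine ⟨(c : S), ⟨1, ?_⟩, fun n hn => ?_⟩
    · rw [one_smul, abs_of_nonneg]
      · exact Germ.coe_le.2 (Eventually.of_forall hch)
      · exact Germ.coe_le.2 (Eventually.of_forall hc0)
    · refine ⟨((fun i => (i.factorial / n) • y i : ℕ → Γ) : S), ?_⟩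
      rw [← Germ.coe_smul, ← Germ.coe_sub]
      refine Germ.coe_eq.2 ?_
      filter_upwards [hU n] with i hi
      change n • ((i.factorial / n) • y i) = x i - c i
      rw [← mul_smul, Nat.mul_div_cancel' (Nat.dvd_factorial (Nat.pos_of_ne_zero hn) hi), hyc]
  have hdiv : IsDivisible (S ⧸ C) := by
    intro n hn a
    induction a using QuotientAddGroup.induction_on with | H g
    obtain ⟨c, hc, hy⟩ := split g
    obtain ⟨y, hy⟩ := hy n hn
    refine ⟨(y : S ⧸ C), ?_⟩
    rw [← QuotientAddGroup.mk_nsmul, hy]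
    refine QuotientAddGroup.eq.2 ?_
    rwa [neg_sub, sub_add_cancel]
  have hnt : Nontrivial (S ⧸ C) := by
    -- This element exceeds every `m • w`, so it lies outside `C`.
    let z : S := ((fun i => (i * i.factorial) • h : ℕ → Γ) : S)
    refine ⟨(z : S ⧸ C), 0, fun hz => ?_⟩
    obtain ⟨m, hm⟩ := (QuotientAddGroup.eq_zero_iff z).1 hz
    have h1 : z ≤ m • w := (le_abs_self z).trans hm
    have h2 : ∀ᶠ i in (U : Filter ℕ), (i * i.factorial) • h ≤ m • (i.factorial • h) :=
      Germ.coe_le.1 h1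
    obtain ⟨i, hi, hmi⟩ := (h2.and (hU (m + 1))).exists
    rw [← mul_smul, nsmul_le_nsmul_iff_left hpos] at hi
    have := Nat.le_of_mul_le_mul_right hi i.factorial_pos
    lia
  obtain ⟨r, hr⟩ := exists_retraction C (fun n x hn hx => mem_of_nsmul_mem C hn hx) split
  let p := LexDecomp.ofRetraction C r hr
  have key : ElemEquiv S (Germ (U : Filter ℕ) ℚ ×ₗ S) :=
    p.elemEquiv hdiv (hdiv.lexProd (isDivisible_germ_rat U)) (p.prod (Germ (U : Filter ℕ) ℚ))
  exact ((elemEquiv_germ U Γ).trans key).trans (elemEquiv_lex_germ U ℚ Γ).symm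

/-! ### Groups of finite rank -/

/-- For `H` maximal among proper convex subgroups, a nontrivial convex subgroup of `Γ/H` pulls back
to all of `Γ`, so the quotient by it is zero. -/
theorem exists_regular_quotient (Γ : Type*) [AddCommGroup Γ] [LinearOrder Γ]
    [IsOrderedAddMonoid Γ] [Nontrivial Γ] (hΓ : HasFiniteRank Γ) :
    ∃ H : AddSubgroup Γ, ∃ _ : (H : Set Γ).OrdConnected, H ≠ ⊤ ∧ IsRegular (Γ ⧸ H) := by
  obtain ⟨H, ⟨hc, hT⟩, hmax⟩ := Set.Finite.exists_maximal hΓ ⟨⊥, by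
    change ((⊥ : AddSubgroup Γ) : Set Γ).OrdConnected
    rw [AddSubgroup.coe_bot]; exact Set.ordConnected_singleton, bot_ne_top⟩
  refine ⟨H, hc, hT, fun p _ K hK hK' a => ?_⟩
  let f := QuotientAddGroup.mk' H
  have hconv : IsConvex (K.comap f) := ⟨fun x hx y hy z hz =>
    hK.out hx hy ⟨⟨x, z, rfl, rfl, hz.1⟩, ⟨z, y, rfl, rfl, hz.2⟩⟩⟩
  have hle : H ≤ K.comap f := fun x hx => by
    have : f x = 0 := (QuotientAddGroup.eq_zero_iff x).2 hx
    rw [AddSubgroup.mem_comap, this]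
    exact K.zero_mem
  have htop : K.comap f = ⊤ := by
    by_contra hne
    have hle' := hmax (y := K.comap f) ⟨hconv, hne⟩ hle
    refine hK' ((AddSubgroup.eq_bot_iff_forall K).2 fun q hq => ?_)
    obtain ⟨x, rfl⟩ := QuotientAddGroup.mk'_surjective H q
    exact (QuotientAddGroup.eq_zero_iff x).2 (hle' hq)
  refine ⟨0, ?_⟩
  induction a using QuotientAddGroup.induction_on with | H q
  obtain ⟨x, rfl⟩ := QuotientAddGroup.mk'_surjective H q
  rw [smul_zero, eq_comm, QuotientAddGroup.eq_zero_iff]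
  have : x ∈ K.comap f := htop ▸ AddSubgroup.mem_top x
  exact this

theorem single_mem_of_mem {n : ℕ} {H : AddSubgroup (ZPow n)} (hH : IsConvex H) {x : Fin n → ℤ}
    (hx : toColex x ∈ H) {j : Fin n} (hj : x j ≠ 0) : toColex (Pi.single j 1) ∈ H := by
  obtain ⟨i, hi, hmax⟩ := (Finset.univ.filter fun i => x i ≠ 0).exists_max_image id
    ⟨j, by simpa using hj⟩
  simp only [Finset.mem_filter, Finset.mem_univ, true_and, id] at hi hmax
  have hji := hmax j hj
  wlog hpos : 0 < x i generalizing x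
  · exact this (x := -x) (H.neg_mem hx) (by simpa using hj) (by simpa using hi)
      (by simpa using hmax) (by have := lt_of_le_of_ne (not_lt.1 hpos) hi; simpa using this)
  have hz : ∀ k, i < k → x k = 0 := fun k hk => by_contra fun h => absurd (hmax k h) (not_le.2 hk)
  -- With `i` the last nonzero coordinate, `0 < e_j < 2x`. The doubling is needed because `x` may
  -- have `x i = 1` and negative earlier coordinates.
  refine hH.out H.zero_mem (H.add_mem hx hx) ⟨le_of_lt ⟨j, fun k hk => ?_, ?_⟩,
    le_of_lt ⟨i, fun k hk => ?_, ?_⟩⟩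
  · change (0 : ℤ) = (Pi.single j 1 : Fin n → ℤ) k
    rw [Pi.single_eq_of_ne (ne_of_gt hk)]
  · change (0 : ℤ) < (Pi.single j 1 : Fin n → ℤ) j
    simp
  · change (Pi.single j 1 : Fin n → ℤ) k = x k + x k
    rw [Pi.single_eq_of_ne (hji.trans_lt hk).ne', hz k hk, add_zero]
  · change (Pi.single j 1 : Fin n → ℤ) i < x i + x i
    rw [Pi.single_apply]
    split_ifs <;> lia

/-- A convex subgroup is generated by the unit vectors it contains, so there are at most `2 ^ n` of
them. -/
theorem hasFiniteRank_zPow (n : ℕ) : HasFiniteRank (ZPow n) := by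
  refine Set.Finite.of_injOn (f := fun H : AddSubgroup (ZPow n) =>
    {i : Fin n | toColex (Pi.single i 1) ∈ H}) (t := Set.univ) (fun _ _ => Set.mem_univ _) ?_
    Set.finite_univ
  have key : ∀ H H' : AddSubgroup (ZPow n), IsConvex H →
      {i : Fin n | toColex (Pi.single i 1) ∈ H} = {i : Fin n | toColex (Pi.single i 1) ∈ H'} →
      H ≤ H' := by
    intro H H' hH heq x hx
    let f : (Fin n → ℤ) →+ ZPow n := AddMonoidHom.mk' toColex fun _ _ => rfl
    have hsum : x = ∑ i, (ofColex x i) • f (Pi.single i 1) := by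
      have : ofColex x = ∑ i, (ofColex x i) • (Pi.single i 1 : Fin n → ℤ) := by
        rw [← Finset.univ_sum_single (ofColex x)]
        refine Finset.sum_congr rfl fun i _ => ?_
        rw [Finset.univ_sum_single, ← Pi.single_smul]
        simp
      have h2 := congrArg f this
      rw [map_sum] at h2
      simp only [map_zsmul] at h2
      exact h2
    rw [hsum]
    refine H'.sum_mem fun i _ => ?_
    by_cases hi : ofColex x i = 0
    · rw [hi, zero_smul]; exact H'.zero_mem
    · exact H'.zsmul_mem ((Set.ext_iff.1 heq i).1 (single_mem_of_mem hH hx hi)) _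
  intro H hH H' hH' heq
  exact le_antisymm (key H H' hH.1 heq) (key H' H hH'.1 heq.symm)

theorem elemEquiv_of_hasFiniteRank (Γ : Type u) [AddCommGroup Γ] [LinearOrder Γ]
    [IsOrderedAddMonoid Γ] [Nontrivial Γ] (hΓ : HasFiniteRank Γ) : ElemEquiv Γ (InvLex Γ ℚ) := by
  obtain ⟨H, hc, hT, hreg⟩ := exists_regular_quotient Γ hΓ
  exact elemEquiv_of_regular_quotient Γ H hT hreg

end OAG

theorem mainTheorem6 :
    (∀ (Γ : Type u) [AddCommGroup Γ] [LinearOrder Γ] [IsOrderedAddMonoid Γ]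
        (H : AddSubgroup Γ) [(H : Set Γ).OrdConnected],
        H ≠ ⊤ → OAG.IsRegular (Γ ⧸ H) → OAG.ElemEquiv Γ (OAG.InvLex Γ ℚ)) ∧
    (∀ (Γ : Type u) [AddCommGroup Γ] [LinearOrder Γ] [IsOrderedAddMonoid Γ] [Nontrivial Γ],
        OAG.HasFiniteRank Γ → OAG.ElemEquiv Γ (OAG.InvLex Γ ℚ)) ∧
    (∀ n : ℕ, 1 ≤ n →
        OAG.HasFiniteRank (OAG.ZPow n) ∧
          OAG.ElemEquiv (OAG.ZPow n) (OAG.InvLex (OAG.ZPow n) ℚ)) := by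
  refine ⟨fun Γ _ _ _ H _ hH hreg => OAG.elemEquiv_of_regular_quotient Γ H hH hreg,
    fun Γ _ _ _ _ hΓ => OAG.elemEquiv_of_hasFiniteRank Γ hΓ, fun n hn => ?_⟩
  have : NeZero n := ⟨Nat.one_le_iff_ne_zero.1 hn⟩
  have : Nontrivial (OAG.ZPow n) := inferInstanceAs (Nontrivial (Fin n → ℤ))
  exact ⟨OAG.hasFiniteRank_zPow n, @OAG.elemEquiv_of_hasFiniteRank (OAG.ZPow n) _ _ (OAG.instZPow n) _
    (OAG.hasFiniteRank_zPow n)⟩
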